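/- Let $d\ge 0$, $m,N\ge 1$, $T>0$, $\tau=T/N$, and $t_k=T-\tau k$ for $k=0,\dots,N$, so that $t_0=T$ and $t_N=0$. Let $S=X_{1:m}=(X_1,\dots,X_m)$ be i.i.d. from a probability measure $P_X$ on $\mathbb{R}^d$. Let $\lambda:\mathbb{R}\to\mathbb{R}$ be a function, and let $s_\theta:\mathbb{R}^d\times[0,T]\to\mathbb{R}^d$ be a score model whose parameter $\theta=\theta(S)$ is a measurable function of the data set, with $(\theta,x)\mapsto s_\theta(x,t)$ measurable for every $t\in[0,T]$. Assume that the score is bounded by $L$: $\|s_{\theta(S)}(x,t)\|\le L$ for all data sets $S$, all $x\in\mathbb{R}^d$ and all $t\in[0,T]$. Let $\hat X_T$ be a starting point such that, for some index $j\in\{1,\dots,m\}$ and some Markov kernel $Q$ on $\mathbb{R}^d$, the conditional law of $\hat X_T$ given $S$ is $Q(X_j,\cdot)$. (If $Q$ is constant and equal to $\pi$, then $\hat X_T\sim\pi$ is independent of $S$; if $Q$ is the forward (encoder) kernel $E_T$, then $\hat X_T\sim E_T(X_j)$.) Let $\epsilon_{t_0},\dots,\epsilon_{t_{N-1}}\sim\mathcal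 N(0,\mathbf I_d)$ be mutually independent, and jointly independent of $(S,\hat X_T)$. Define the Euler–Maruyama discretization of the backward SDE by, for $k=1,\dots,N$, $$\hat X_{t_k}=\Big(1-\frac{\tau}{2}\lambda^2(T-t_{k-1})\Big)\hat X_{t_{k-1}}+\tau\lambda^2(T-t_{k-1})\,s_{\theta(S)}(\hat X_{t_{k-1}},T-t_{k-1})+\sqrt{\tau}\,\lambda(T-t_{k-1})\,\epsilon_{t_{k-1}}.$$ Then $$\frac1m\sum_{i=1}^m I(\hat X_0;X_i\mid\hat X_T)\;\le\;\frac1m I(\hat X_0;X_{1:m}\mid\hat X_T)\;\le\;\frac{T L^2\sum_{k=1}^N\lambda^2\!\big(\tfrac{(k-1)T}{N}\big)}{2mN},$$ where $I(X;Y\mid Z)=\mathbb E_Z\big[D_{\mathrm{KL}}(P_{X,Y\mid Z}\,\|\,P_{X\mid Z}\otimes P_{Y\mid Z})\big]\in[0,\infty]$ is the conditional mutual information (in nats). -/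

import Mathlib

open MeasureTheory ProbabilityTheory InformationTheory
open scoped ENNReal

noncomputable section

/-- The disintegrated mutual information `I^{Z=z}(X; Y) = KL(P_{X,Y|Z=z} ‖ P_{X|Z=z} ⊗ P_{Y|Z=z})`,
in nats, with values in `[0, ∞]`. -/
def disintegratedMutualInfo {Ω 𝓧 𝓨 𝓩 : Type*} [MeasurableSpace Ω]
    [MeasurableSpace 𝓧] [StandardBorelSpace 𝓧] [Nonempty 𝓧]
    [MeasurableSpace 𝓨] [StandardBorelSpace 𝓨] [Nonempty 𝓨] [MeasurableSpace 𝓩]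
    (X : Ω → 𝓧) (Y : Ω → 𝓨) (Z : Ω → 𝓩) (μ : Measure Ω) [IsFiniteMeasure μ] (z : 𝓩) : ℝ≥0∞ :=
  klDiv (condDistrib (fun ω => (X ω, Y ω)) Z μ z)
    ((condDistrib X Z μ z).prod (condDistrib Y Z μ z))

/-- The conditional mutual information `I(X; Y | Z) = 𝔼_Z [I^Z(X; Y)]`. -/
def condMutualInfo {Ω 𝓧 𝓨 𝓩 : Type*} [MeasurableSpace Ω]
    [MeasurableSpace 𝓧] [StandardBorelSpace 𝓧] [Nonempty 𝓧]
    [MeasurableSpace 𝓨] [StandardBorelSpace 𝓨] [Nonempty 𝓨] [MeasurableSpace 𝓩]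
    (X : Ω → 𝓧) (Y : Ω → 𝓨) (Z : Ω → 𝓩) (μ : Measure Ω) [IsFiniteMeasure μ] : ℝ≥0∞ :=
  ∫⁻ z, disintegratedMutualInfo X Y Z μ z ∂(μ.map Z)

/-- The discretization times `t_k = T - τ k`, with step size `τ = T / N`, of the backward process:
`t_0 = T` and `t_N = 0`. -/
def backwardTime (T : ℝ) (N k : ℕ) : ℝ := T - T / N * k

/-- One Euler-Maruyama step of the backward SDE, from time `t = t_{k-1}` to time `t_k = t - τ`:
`x ↦ (1 - τ/2 λ²(T - t)) x + τ λ²(T - t) s(x, T - t) + √τ λ(T - t) e`,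
with diffusion coefficient `lam`, score model `s`, and Gaussian noise `e`. -/
def eulerMaruyamaStep {E : Type*} [AddCommGroup E] [Module ℝ E]
    (T τ : ℝ) (lam : ℝ → ℝ) (s : E → ℝ → E) (t : ℝ) (x e : E) : E :=
  (1 - τ / 2 * lam (T - t) ^ 2) • x + (τ * lam (T - t) ^ 2) • s x (T - t)
    + (Real.sqrt τ * lam (T - t)) • e

end

/-!
Fix the starting point `z`. For both inequalities it is enough to argue with the conditional laws
given `Xhat 0 = z`, for almost every `z`.

For the upper bound, compare the joint law of the training set `S` and of the `k`-th iterate with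
the law obtained by removing the score from the recursion, under which the iterate is independent
of `S`. One step shifts its Gaussian noise by `√τ λ s`, where `s` is the score; by the
Cameron-Martin formula (`stdGaussian_map_add_right`) such a shift costs at most `τ λ² L² / 2` in
relative entropy (`klDiv_compProd_gaussianShiftKernel_le`). By the chain rule and the data
processing inequality the costs of the steps add up (`exists_klDiv_condDistrib_iterate_le`). The
mutual information between the output and `S` is the least relative entropy of their joint law to
the product of any law with the law of `S` (`klDiv_prod_marginals_le`), so it is at most the total
cost.

For the comparison of the informations, the starting point depends on `S` through the single
example `X j`, so the examples stay independent given the starting point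
(`condDistrib_eq_pi_of_hasLaw`), and mutual information is superadditive in independent variables
(`sum_klDiv_map_le_klDiv_pi`), again by the chain rule.
-/

/-! ### Translates of the standard Gaussian measure -/

section Gaussian

variable {d : ℕ}

/-- The Laplace transform of the standard Gaussian measure at the complex vector `u + i t`, computed
coordinatewise. -/
lemma integral_cexp_inner_stdGaussian (u t : EuclideanSpace ℝ (Fin d)) :
    ∫ e, Complex.exp (inner ℝ e u + inner ℝ e t * Complex.I)
        ∂(stdGaussian (EuclideanSpace ℝ (Fin d)))
      = Complex.exp ((‖u‖ ^ 2 - ‖t‖ ^ 2) / 2 + inner ℝ u t * Complex.I) := by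
  have key (i : Fin d) : ∫ x : ℝ, Complex.exp ((u i + t i * Complex.I) * x) ∂(gaussianReal 0 1)
      = Complex.exp ((u i + t i * Complex.I) ^ 2 / 2) := by
    simpa [complexMGF] using
      complexMGF_id_gaussianReal (μ := 0) (v := 1) (u i + t i * Complex.I)
  rw [← map_pi_eq_stdGaussian, integral_map (by fun_prop)
    (Measurable.aestronglyMeasurable (by fun_prop))]
  have h (x : Fin d → ℝ) : Complex.exp (inner ℝ (WithLp.toLp 2 x) u
      + inner ℝ (WithLp.toLp 2 x) t * Complex.I)
      = ∏ i, Complex.exp ((u i + t i * Complex.I) * x i) := by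
    rw [← Complex.exp_sum]
    simp only [PiLp.inner_apply, RCLike.inner_apply, conj_trivial, Complex.ofReal_sum,
      Complex.ofReal_mul, Finset.sum_mul, ← Finset.sum_add_distrib]
    congr 1
    refine Finset.sum_congr rfl fun i _ => ?_
    ring
  simp_rw [h]
  rw [integral_fintype_prod_eq_prod (f := fun (i : Fin d) (x : ℝ) =>
    Complex.exp ((u i + t i * Complex.I) * x))]
  simp_rw [key]
  rw [← Complex.exp_sum]
  congr 1
  rw [← Complex.ofReal_pow, ← Complex.ofReal_pow, EuclideanSpace.real_norm_sq_eq,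
    EuclideanSpace.real_norm_sq_eq]
  simp only [PiLp.inner_apply, RCLike.inner_apply, conj_trivial, Complex.ofReal_sum,
    Complex.ofReal_mul, Complex.ofReal_pow, Finset.sum_mul, ← Finset.sum_add_distrib,
    ← Finset.sum_sub_distrib, Finset.sum_div]
  refine Finset.sum_congr rfl fun i _ => ?_
  linear_combination (t i : ℂ) ^ 2 / 2 * Complex.I_sq

lemma integrable_exp_inner_stdGaussian (u : EuclideanSpace ℝ (Fin d)) :
    Integrable (fun e => Real.exp (inner ℝ e u)) (stdGaussian (EuclideanSpace ℝ (Fin d))) := by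
  rw [← map_pi_eq_stdGaussian, integrable_map_measure
    (Measurable.aestronglyMeasurable (by fun_prop)) (by fun_prop)]
  have h : (fun e : EuclideanSpace ℝ (Fin d) => Real.exp (inner ℝ e u)) ∘ WithLp.toLp 2
      = fun x : Fin d → ℝ => ∏ i, Real.exp (u i * x i) := by
    ext x
    rw [← Real.exp_sum]
    simp [PiLp.inner_apply, mul_comm]
  rw [h]
  exact Integrable.fintype_prod fun i => integrable_exp_mul_gaussianReal (u i)

/-- The density of the standard Gaussian measure translated by `u`, with respect to the standard
Gaussian measure. -/
noncomputable def gaussianShiftDensity (u e : EuclideanSpace ℝ (Fin d)) : ℝ :=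
  Real.exp (inner ℝ e u - ‖u‖ ^ 2 / 2)

/-- The Cameron-Martin formula in finite dimension, obtained by comparing characteristic
functions. -/
lemma stdGaussian_map_add_right (u : EuclideanSpace ℝ (Fin d)) :
    (stdGaussian (EuclideanSpace ℝ (Fin d))).map (fun e => e + u)
      = (stdGaussian (EuclideanSpace ℝ (Fin d))).withDensity
          (fun e => ENNReal.ofReal (gaussianShiftDensity u e)) := by
  have hint : Integrable (gaussianShiftDensity u) (stdGaussian (EuclideanSpace ℝ (Fin d))) := by
    unfold gaussianShiftDensity
    simp_rw [Real.exp_sub]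
    exact (integrable_exp_inner_stdGaussian u).div_const _
  have hmeas : Measurable (fun e => ENNReal.ofReal (gaussianShiftDensity u e)) := by
    unfold gaussianShiftDensity
    fun_prop
  have : IsFiniteMeasure ((stdGaussian (EuclideanSpace ℝ (Fin d))).withDensity
      (fun e => ENNReal.ofReal (gaussianShiftDensity u e))) :=
    isFiniteMeasure_withDensity_ofReal hint.2
  refine Measure.ext_of_charFun (funext fun t => ?_)
  rw [charFun_map_add_const, charFun_stdGaussian, charFun_apply,
    integral_withDensity_eq_integral_toReal_smul hmeas (by simp)]
  have h (e : EuclideanSpace ℝ (Fin d)) :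
      (ENNReal.ofReal (gaussianShiftDensity u e)).toReal • Complex.exp (inner ℝ e t * Complex.I)
      = Complex.exp (-‖u‖ ^ 2 / 2)
        * Complex.exp (inner ℝ e u + inner ℝ e t * Complex.I) := by
    rw [gaussianShiftDensity, ENNReal.toReal_ofReal (Real.exp_pos _).le, Complex.real_smul,
      Complex.ofReal_exp, ← Complex.exp_add, ← Complex.exp_add]
    congr 1
    push_cast
    ring
  simp_rw [h]
  rw [integral_const_mul, integral_cexp_inner_stdGaussian, ← Complex.exp_add, ← Complex.exp_add]
  congr 1
  rw [real_inner_comm]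
  ring

end Gaussian

section GaussianShiftKernel

variable {d : ℕ} {𝒴 : Type*} [MeasurableSpace 𝒴]

/-- The Markov kernel `y ↦ 𝒩(u y, I)`. -/
noncomputable def gaussianShiftKernel (u : 𝒴 → EuclideanSpace ℝ (Fin d)) :
    Kernel 𝒴 (EuclideanSpace ℝ (Fin d)) :=
  (Kernel.id ×ₖ Kernel.const 𝒴 (stdGaussian (EuclideanSpace ℝ (Fin d)))).map
    (fun q => q.2 + u q.1)

lemma gaussianShiftKernel_apply {u : 𝒴 → EuclideanSpace ℝ (Fin d)} (hu : Measurable u) (y : 𝒴) :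
    gaussianShiftKernel u y
      = (stdGaussian (EuclideanSpace ℝ (Fin d))).map (fun e => e + u y) := by
  rw [gaussianShiftKernel, Kernel.map_apply _ (by fun_prop), Kernel.prod_apply, Kernel.id_apply,
    Kernel.const_apply, Measure.dirac_prod, Measure.map_map (by fun_prop) (by fun_prop)]
  rfl

lemma isMarkovKernel_gaussianShiftKernel {u : 𝒴 → EuclideanSpace ℝ (Fin d)} (hu : Measurable u) :
    IsMarkovKernel (gaussianShiftKernel u) :=
  Kernel.IsMarkovKernel.map _ (by fun_prop)

lemma compProd_gaussianShiftKernel {u : 𝒴 → EuclideanSpace ℝ (Fin d)} (hu : Measurable u)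
    (p : Measure 𝒴) [IsProbabilityMeasure p] :
    p ⊗ₘ gaussianShiftKernel u
      = (p.prod (stdGaussian (EuclideanSpace ℝ (Fin d)))).map (fun q => (q.1, q.2 + u q.1)) := by
  have := isMarkovKernel_gaussianShiftKernel hu
  refine Measure.ext_of_lintegral _ fun f hf => ?_
  rw [Measure.lintegral_compProd hf, lintegral_map hf (by fun_prop),
    lintegral_prod _ (by fun_prop)]
  refine lintegral_congr fun y => ?_
  rw [gaussianShiftKernel_apply hu, lintegral_map (by fun_prop) (by fun_prop)]

lemma compProd_gaussianShiftKernel_eq_withDensity {u : 𝒴 → EuclideanSpace ℝ (Fin d)}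
    (hu : Measurable u) (p : Measure 𝒴) [IsProbabilityMeasure p] :
    p ⊗ₘ gaussianShiftKernel u
      = (p.prod (stdGaussian (EuclideanSpace ℝ (Fin d)))).withDensity
          (fun q => ENNReal.ofReal (gaussianShiftDensity (u q.1) q.2)) := by
  have := isMarkovKernel_gaussianShiftKernel hu
  have hm : Measurable (fun q : 𝒴 × EuclideanSpace ℝ (Fin d) =>
      ENNReal.ofReal (gaussianShiftDensity (u q.1) q.2)) := by
    unfold gaussianShiftDensity
    fun_prop
  refine Measure.ext_of_lintegral _ fun f hf => ?_
  rw [Measure.lintegral_compProd hf, lintegral_withDensity_eq_lintegral_mul _ hm hf,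
    lintegral_prod _ (hm.mul hf).aemeasurable]
  refine lintegral_congr fun y => ?_
  rw [gaussianShiftKernel_apply hu, stdGaussian_map_add_right,
    lintegral_withDensity_eq_lintegral_mul _ (by unfold gaussianShiftDensity; fun_prop)
      (by fun_prop)]
  rfl

/-- A bounded translation of a standard Gaussian noise costs at most half the square of the bound
in relative entropy: the log-likelihood ratio is `⟪e, u⟫ - ‖u‖² / 2`, whose mean under the
translated Gaussian is `‖u‖² / 2`. -/
lemma klDiv_compProd_gaussianShiftKernel_le {u : 𝒴 → EuclideanSpace ℝ (Fin d)}
    (hu : Measurable u) (p : Measure 𝒴) [IsProbabilityMeasure p] {C : ℝ}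
    (hC : ∀ y, ‖u y‖ ^ 2 ≤ C) :
    klDiv (p ⊗ₘ gaussianShiftKernel u)
        (p ⊗ₘ Kernel.const 𝒴 (stdGaussian (EuclideanSpace ℝ (Fin d))))
      ≤ ENNReal.ofReal (C / 2) := by
  have := isMarkovKernel_gaussianShiftKernel hu
  have hm : Measurable (fun q : 𝒴 × EuclideanSpace ℝ (Fin d) =>
      ENNReal.ofReal (gaussianShiftDensity (u q.1) q.2)) := by
    unfold gaussianShiftDensity
    fun_prop
  have hwd := compProd_gaussianShiftKernel_eq_withDensity hu p
  have hac : p ⊗ₘ gaussianShiftKernel u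
      ≪ p ⊗ₘ Kernel.const 𝒴 (stdGaussian (EuclideanSpace ℝ (Fin d))) := by
    rw [Measure.compProd_const, hwd]
    exact withDensity_absolutelyContinuous _ _
  have hllr : llr (p ⊗ₘ gaussianShiftKernel u)
      (p ⊗ₘ Kernel.const 𝒴 (stdGaussian (EuclideanSpace ℝ (Fin d))))
      =ᵐ[p ⊗ₘ gaussianShiftKernel u]
        fun q => inner ℝ q.2 (u q.1) - ‖u q.1‖ ^ 2 / 2 := by
    refine hac.ae_le ?_
    rw [Measure.compProd_const, hwd]
    filter_upwards [Measure.rnDeriv_withDensity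
      (p.prod (stdGaussian (EuclideanSpace ℝ (Fin d)))) hm] with q hq
    rw [llr, hq, gaussianShiftDensity, ENNReal.toReal_ofReal (Real.exp_pos _).le, Real.log_exp]
  have hbound (y : 𝒴) : ‖u y‖ ≤ √C := Real.le_sqrt_of_sq_le (hC y)
  -- pulled back to the untranslated noise, the log-likelihood ratio is `⟪e, u⟫ + ‖u‖² / 2`
  have hpull (q : 𝒴 × EuclideanSpace ℝ (Fin d)) :
      inner ℝ (q.2 + u q.1) (u q.1) - ‖u q.1‖ ^ 2 / 2
        = inner ℝ q.2 (u q.1) + ‖u q.1‖ ^ 2 / 2 := by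
    rw [inner_add_left, real_inner_self_eq_norm_sq]
    ring
  have hnorm : Integrable (fun q : 𝒴 × EuclideanSpace ℝ (Fin d) => ‖u q.1‖ ^ 2 / 2)
      (p.prod (stdGaussian (EuclideanSpace ℝ (Fin d)))) := by
    refine Integrable.of_bound (C := C / 2)
      (Measurable.aestronglyMeasurable (by fun_prop)) (ae_of_all _ fun q => ?_)
    rw [Real.norm_of_nonneg (by positivity)]
    linarith [hC q.1]
  have hinner : Integrable (fun q : 𝒴 × EuclideanSpace ℝ (Fin d) => inner ℝ q.2 (u q.1))
      (p.prod (stdGaussian (EuclideanSpace ℝ (Fin d)))) := by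
    have hid : Integrable (fun q : 𝒴 × EuclideanSpace ℝ (Fin d) => q.2)
        (p.prod (stdGaussian (EuclideanSpace ℝ (Fin d)))) :=
      IsGaussian.integrable_id.comp_snd p
    refine Integrable.mono' (hid.norm.mul_const √C)
      (Measurable.aestronglyMeasurable (by fun_prop)) (ae_of_all _ fun q => ?_)
    exact (norm_inner_le_norm _ _).trans
      (mul_le_mul_of_nonneg_left (hbound q.1) (norm_nonneg _))
  have hint : Integrable (llr (p ⊗ₘ gaussianShiftKernel u)
      (p ⊗ₘ Kernel.const 𝒴 (stdGaussian (EuclideanSpace ℝ (Fin d)))))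
      (p ⊗ₘ gaussianShiftKernel u) := by
    rw [integrable_congr hllr, compProd_gaussianShiftKernel hu, integrable_map_measure
      (Measurable.aestronglyMeasurable (by fun_prop)) (by fun_prop)]
    refine (hinner.add hnorm).congr (ae_of_all _ fun q => ?_)
    exact (hpull q).symm
  rw [← ENNReal.ofReal_toReal (klDiv_ne_top hac hint),
    toReal_klDiv_of_measure_eq hac (by simp), integral_congr_ae hllr,
    compProd_gaussianShiftKernel hu,
    integral_map (by fun_prop) (Measurable.aestronglyMeasurable (by fun_prop))]
  refine ENNReal.ofReal_le_ofReal ?_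
  simp_rw [hpull]
  rw [integral_add hinner hnorm, integral_prod _ hinner]
  have hzero (y : 𝒴) : ∫ e, inner ℝ e (u y) ∂(stdGaussian (EuclideanSpace ℝ (Fin d))) = 0 := by
    simpa [real_inner_comm] using
      integral_strongDual_stdGaussian (E := EuclideanSpace ℝ (Fin d)) (innerSL ℝ (u y))
  simp_rw [hzero]
  rw [integral_zero, zero_add]
  calc ∫ q, ‖u q.1‖ ^ 2 / 2 ∂(p.prod (stdGaussian (EuclideanSpace ℝ (Fin d))))
      ≤ ∫ _, C / 2 ∂(p.prod (stdGaussian (EuclideanSpace ℝ (Fin d)))) :=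
        integral_mono hnorm (integrable_const _) fun q => by
          change ‖u q.1‖ ^ 2 / 2 ≤ C / 2
          linarith [hC q.1]
    _ = C / 2 := by simp

end GaussianShiftKernel

/-! ### Relative entropy with respect to product measures -/

section KullbackLeibler

variable {α β 𝒲 : Type*} [MeasurableSpace α] [MeasurableSpace β] [MeasurableSpace 𝒲]

lemma klDiv_map_measurableEquiv (e : α ≃ᵐ β) (μ ν : Measure α) [IsFiniteMeasure μ]
    [IsFiniteMeasure ν] : klDiv (μ.map e) (ν.map e) = klDiv μ ν := by
  refine le_antisymm (klDiv_map_le _ _ e.measurable) ?_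
  have h := klDiv_map_le (μ.map e) (ν.map e) e.symm.measurable
  simpa [Measure.map_map e.symm.measurable e.measurable] using h

/-- The chain rule, applied to the disintegration of a joint law `ρ` along its first marginal. -/
lemma klDiv_prod_eq_add [StandardBorelSpace β] [Nonempty β] (ρ : Measure (α × β))
    [IsProbabilityMeasure ρ] (ν : Measure α) [IsProbabilityMeasure ν] (η : Measure β)
    [IsProbabilityMeasure η] :
    klDiv ρ (ν.prod η) = klDiv ρ.fst ν + klDiv ρ (ρ.fst.prod η) := by
  have h := klDiv_compProd_eq_add ρ.fst ν ρ.condKernel (Kernel.const α η)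
  rwa [Measure.disintegrate, Measure.compProd_const, Measure.compProd_const] at h

/-- Mutual information is at most the relative entropy of the joint law to any product measure that
keeps the second marginal. -/
lemma klDiv_prod_marginals_le [StandardBorelSpace β] [Nonempty β] (ρ : Measure (α × β))
    [IsProbabilityMeasure ρ] (η : Measure α) [IsProbabilityMeasure η] :
    klDiv ρ (ρ.fst.prod ρ.snd) ≤ klDiv ρ (η.prod ρ.snd) := by
  rw [klDiv_prod_eq_add ρ η ρ.snd]
  exact le_add_self

/-- Two-coordinate case of `sum_klDiv_map_le_klDiv_pi`. By the chain rule, the right-hand side is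
the first term plus the relative entropy of `((w, a), b)` to a law where `b` is independent with law
`η`; the latter dominates the second term by forgetting `a`. -/
lemma klDiv_map_add_klDiv_map_le [StandardBorelSpace β] [Nonempty β]
    (ρ : Measure (𝒲 × α × β)) [IsProbabilityMeasure ρ] (ν : Measure α) [IsProbabilityMeasure ν]
    (η : Measure β) [IsProbabilityMeasure η] :
    klDiv (ρ.map fun q => (q.1, q.2.1)) (ρ.fst.prod ν)
        + klDiv (ρ.map fun q => (q.1, q.2.2)) (ρ.fst.prod η)
      ≤ klDiv ρ (ρ.fst.prod (ν.prod η)) := by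
  set ρ' := ρ.map MeasurableEquiv.prodAssoc.symm with hρ'
  have : IsProbabilityMeasure ρ' :=
    Measure.isProbabilityMeasure_map (by fun_prop)
  have hfst : ρ'.fst = ρ.map fun q => (q.1, q.2.1) := by
    rw [hρ', Measure.fst, Measure.map_map measurable_fst (MeasurableEquiv.measurable _)]
    rfl
  have : IsProbabilityMeasure (ρ.map fun q => (q.1, q.2.1)) :=
    Measure.isProbabilityMeasure_map (by fun_prop)
  have hfst2 : ρ'.fst.fst = ρ.fst := by
    rw [hfst, Measure.fst, Measure.fst, Measure.map_map measurable_fst (by fun_prop)]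
    rfl
  have hprod : (ρ.fst.prod (ν.prod η)).map MeasurableEquiv.prodAssoc.symm
      = (ρ.fst.prod ν).prod η := by
    rw [← Measure.prodAssoc_prod, Measure.map_map (MeasurableEquiv.measurable _)
      (MeasurableEquiv.measurable _)]
    simp
  have hmeq := klDiv_map_measurableEquiv MeasurableEquiv.prodAssoc.symm ρ
    (ρ.fst.prod (ν.prod η))
  rw [← hmeq, hprod, ← hρ',
    klDiv_prod_eq_add ρ' (ρ.fst.prod ν) η, ← hfst]
  gcongr
  -- forget the middle coordinate
  have h := klDiv_map_le ρ' (ρ'.fst.prod η) (g := Prod.map Prod.fst id) (by fun_prop)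
  rw [← Measure.map_prod_map _ _ measurable_fst measurable_id, Measure.map_id,
    show ρ'.fst.map Prod.fst = ρ.fst from hfst2, hρ',
    Measure.map_map (by fun_prop) (MeasurableEquiv.measurable _)] at h
  exact h

/-- Superadditivity of relative entropy over independent coordinates: by the chain rule, the
information about all coordinates dominates the sum of the informations about each of them. -/
lemma sum_klDiv_map_le_klDiv_pi [StandardBorelSpace α] [Nonempty α] {n : ℕ}
    (ν : Fin n → Measure α) [∀ i, IsProbabilityMeasure (ν i)]
    (ρ : Measure (𝒲 × (Fin n → α))) [IsProbabilityMeasure ρ] :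
    ∑ i, klDiv (ρ.map fun q => (q.1, q.2 i)) (ρ.fst.prod (ν i))
      ≤ klDiv ρ (ρ.fst.prod (Measure.pi ν)) := by
  induction n with
  | zero => simp
  | succ n ih =>
    let e : (𝒲 × (Fin (n + 1) → α)) ≃ᵐ 𝒲 × α × (Fin n → α) :=
      MeasurableEquiv.prodCongr (MeasurableEquiv.refl 𝒲)
        (MeasurableEquiv.piFinSuccAbove (fun _ => α) 0)
    set ρ' := ρ.map e with hρ'
    have : IsProbabilityMeasure ρ' := Measure.isProbabilityMeasure_map (by fun_prop)
    have hfst : ρ'.fst = ρ.fst := by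
      rw [hρ', Measure.fst, Measure.map_map measurable_fst e.measurable]
      rfl
    set ρ'' := ρ'.map (fun q => (q.1, q.2.2)) with hρ''
    have : IsProbabilityMeasure ρ'' := Measure.isProbabilityMeasure_map (by fun_prop)
    have hfst' : ρ''.fst = ρ.fst := by
      rw [hρ'', Measure.fst, Measure.map_map measurable_fst (by fun_prop), ← hfst]
      rfl
    have hprod : (ρ.fst.prod (Measure.pi ν)).map e
        = ρ.fst.prod ((ν 0).prod (Measure.pi fun i => ν i.succ)) := by
      have h := (measurePreserving_piFinSuccAbove ν 0).map_eq
      simp only [Fin.succAbove_zero] at h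
      rw [← h]
      conv_rhs => rw [← Measure.map_id (μ := ρ.fst)]
      rw [Measure.map_prod_map _ _ measurable_id (MeasurableEquiv.measurable _)]
      rfl
    rw [← klDiv_map_measurableEquiv e ρ, hprod, ← hρ', Fin.sum_univ_succ]
    refine le_trans ?_ (hfst ▸ klDiv_map_add_klDiv_map_le ρ' (ν 0) (Measure.pi fun i => ν i.succ))
    have h := ih (fun i => ν i.succ) ρ''
    rw [hfst'] at h
    have h0 : ρ'.map (fun q => (q.1, q.2.1)) = ρ.map fun q => (q.1, q.2 0) := by
      rw [hρ', Measure.map_map (by fun_prop) e.measurable]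
      rfl
    have hs (i : Fin n) : ρ''.map (fun q => (q.1, q.2 i)) = ρ.map fun q => (q.1, q.2 i.succ) := by
      rw [hρ'', hρ', Measure.map_map (by fun_prop) (by fun_prop),
        Measure.map_map (by fun_prop) e.measurable]
      rfl
    simp_rw [hs] at h
    rw [h0]
    gcongr

end KullbackLeibler

/-! ### Conditional distributions and independence -/

section CondDistrib

variable {Ω α β γ 𝒵 : Type*} [MeasurableSpace Ω] [MeasurableSpace α] [MeasurableSpace β]
  [MeasurableSpace γ] [MeasurableSpace 𝒵] {μ : Measure Ω} [IsProbabilityMeasure μ]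

lemma IndepFun.prodMk_left_of_prodMk_right {U : Ω → α} {A : Ω → β} {B : Ω → γ}
    (hU : AEMeasurable U μ) (hA : AEMeasurable A μ) (hB : AEMeasurable B μ)
    (h : IndepFun U (fun ω => (A ω, B ω)) μ) (hAB : IndepFun A B μ) :
    IndepFun (fun ω => (U ω, A ω)) B μ := by
  have := Measure.isProbabilityMeasure_map (μ := μ) hU
  have := Measure.isProbabilityMeasure_map (μ := μ) hA
  have := Measure.isProbabilityMeasure_map (μ := μ) hB
  have hUA : IndepFun U A μ := h.comp measurable_id measurable_fst
  rw [indepFun_iff_map_prod_eq_prod_map_map (by fun_prop) (by fun_prop)] at h hAB hUA ⊢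
  rw [hUA]
  rw [hAB, ← Measure.prodAssoc_prod] at h
  apply_fun (fun ν => ν.map MeasurableEquiv.prodAssoc.symm) at h
  rw [AEMeasurable.map_map_of_aemeasurable (by fun_prop) (by fun_prop),
    Measure.map_map (by fun_prop) (by fun_prop), MeasurableEquiv.symm_comp_self,
    Measure.map_id] at h
  exact h

lemma condDistrib_prodMk_of_indepFun [StandardBorelSpace α] [Nonempty α] [StandardBorelSpace β]
    [Nonempty β] {Y : Ω → α} {e : Ω → β} {Z : Ω → 𝒵} (hY : AEMeasurable Y μ)
    (he : AEMeasurable e μ) (hZ : AEMeasurable Z μ)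
    (h : IndepFun (fun ω => (Z ω, Y ω)) e μ) :
    ∀ᵐ z ∂(μ.map Z), condDistrib (fun ω => (Y ω, e ω)) Z μ z
      = (condDistrib Y Z μ z).prod (μ.map e) := by
  have := Measure.isProbabilityMeasure_map (μ := μ) hZ
  have := Measure.isProbabilityMeasure_map (μ := μ) he
  have key := condDistrib_ae_eq_of_measure_eq_compProd Z (hY.prodMk he)
    (κ := condDistrib Y Z μ ×ₖ Kernel.const 𝒵 (μ.map e)) ?_
  · filter_upwards [key] with z hz
    rw [hz, Kernel.prod_apply, Kernel.const_apply]
  rw [indepFun_iff_map_prod_eq_prod_map_map (by fun_prop) (by fun_prop),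
    ← compProd_map_condDistrib hY] at h
  refine Measure.ext_of_lintegral _ fun f hf => ?_
  have h' : μ.map (fun ω => (Z ω, Y ω, e ω))
      = (μ.map (fun ω => ((Z ω, Y ω), e ω))).map MeasurableEquiv.prodAssoc := by
    rw [AEMeasurable.map_map_of_aemeasurable (by fun_prop) (by fun_prop)]
    rfl
  have hg : Measurable fun q : (𝒵 × α) × β => f (q.1.1, q.1.2, q.2) := by fun_prop
  rw [h', h, lintegral_map hf (by fun_prop), Measure.lintegral_compProd hf]
  change ∫⁻ q : (𝒵 × α) × β, f (q.1.1, q.1.2, q.2) ∂_ = _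
  rw [lintegral_prod _ hg.aemeasurable, Measure.lintegral_compProd hg.lintegral_prod_right']
  refine lintegral_congr fun z => ?_
  rw [Kernel.prod_apply, Kernel.const_apply, lintegral_prod _ (by fun_prop)]

/-- Given `Z`, a function of `Y` and of a noise independent of `(Z, Y)` has the law obtained by
adjoining the noise independently to the conditional law of `Y`. -/
lemma condDistrib_comp_prodMk_of_indepFun [StandardBorelSpace α] [Nonempty α]
    [StandardBorelSpace β] [Nonempty β] [StandardBorelSpace γ] [Nonempty γ]
    {Y : Ω → α} {e : Ω → β} {Z : Ω → 𝒵} (hY : AEMeasurable Y μ)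
    (he : AEMeasurable e μ) (hZ : AEMeasurable Z μ)
    (h : IndepFun (fun ω => (Z ω, Y ω)) e μ) {g : α × β → γ} (hg : Measurable g) :
    ∀ᵐ z ∂(μ.map Z), condDistrib (fun ω => g (Y ω, e ω)) Z μ z
      = ((condDistrib Y Z μ z).prod (μ.map e)).map g := by
  filter_upwards [condDistrib_prodMk_of_indepFun hY he hZ h,
    condDistrib_comp Z (hY.prodMk he) hg] with z hz hz'
  rw [← hz, ← Kernel.map_apply _ hg, ← hz']
  rfl

lemma condDistrib_comp_apply [StandardBorelSpace α] [Nonempty α]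
    [StandardBorelSpace γ] [Nonempty γ] {Y : Ω → α} (Z : Ω → 𝒵) (hY : AEMeasurable Y μ)
    {g : α → γ} (hg : Measurable g) :
    ∀ᵐ z ∂(μ.map Z), condDistrib (fun ω => g (Y ω)) Z μ z = (condDistrib Y Z μ z).map g := by
  filter_upwards [condDistrib_comp Z hY hg] with z hz
  rw [← Kernel.map_apply _ hg, ← hz]
  rfl

lemma condDistrib_prodMk_self [StandardBorelSpace α] [Nonempty α] [StandardBorelSpace 𝒵]
    [Nonempty 𝒵] {Y : Ω → α} {Z : Ω → 𝒵} (hY : AEMeasurable Y μ) (hZ : AEMeasurable Z μ) :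
    ∀ᵐ z ∂(μ.map Z), condDistrib (fun ω => (Y ω, Z ω)) Z μ z
      = (condDistrib Y Z μ z).prod (Measure.dirac z) := by
  have := Measure.isProbabilityMeasure_map (μ := μ) hZ
  have key := condDistrib_ae_eq_of_measure_eq_compProd Z (hY.prodMk hZ)
    (κ := condDistrib Y Z μ ×ₖ Kernel.id) ?_
  · filter_upwards [key] with z hz
    rw [hz, Kernel.prod_apply, Kernel.id_apply]
  refine Measure.ext_of_lintegral _ fun f hf => ?_
  have h' : μ.map (fun ω => (Z ω, Y ω, Z ω))
      = (μ.map (fun ω => (Z ω, Y ω))).map (fun q => (q.1, q.2, q.1)) := by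
    rw [AEMeasurable.map_map_of_aemeasurable (by fun_prop) (by fun_prop)]
    rfl
  rw [h', ← compProd_map_condDistrib hY, lintegral_map hf (by fun_prop),
    Measure.lintegral_compProd hf, Measure.lintegral_compProd (by fun_prop)]
  refine lintegral_congr fun z => ?_
  rw [Kernel.prod_apply, Kernel.id_apply, lintegral_prod _ (by fun_prop)]
  refine lintegral_congr fun y => ?_
  rw [lintegral_dirac' _ (by fun_prop)]

end CondDistrib

/-! ### Superadditivity of conditional mutual information -/

section Superadditivity

lemma sum_lintegral_le_lintegral_sum {α ι : Type*} [MeasurableSpace α] (μ : Measure α)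
    (s : Finset ι) (f : ι → α → ℝ≥0∞) :
    ∑ i ∈ s, ∫⁻ a, f i a ∂μ ≤ ∫⁻ a, ∑ i ∈ s, f i a ∂μ := by
  classical
  induction s using Finset.induction_on with
  | empty => simp
  | insert i s hi ih =>
    simp_rw [Finset.sum_insert hi]
    exact (add_le_add_right ih _).trans (le_lintegral_add _ _)

variable {Ω α 𝒲 𝒵 : Type*} [MeasurableSpace Ω] [MeasurableSpace α] [StandardBorelSpace α]
  [Nonempty α] [MeasurableSpace 𝒲] [StandardBorelSpace 𝒲] [Nonempty 𝒲] [MeasurableSpace 𝒵]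
  {μ : Measure Ω} [IsProbabilityMeasure μ]

/-- Conditional mutual information is superadditive in conditionally independent variables. The
argument is pointwise in the conditioning variable, so the measurability of the relative entropy in
that variable is never needed: the lower integral is superadditive for all functions. -/
lemma sum_condMutualInfo_le_of_condDistrib_eq_pi {n : ℕ} {W : Ω → 𝒲} {Y : Fin n → Ω → α}
    {Z : Ω → 𝒵} (hW : AEMeasurable W μ) (hY : AEMeasurable (fun ω i => Y i ω) μ)
    (h : ∀ᵐ z ∂(μ.map Z), ∃ ν : Fin n → Measure α, (∀ i, IsProbabilityMeasure (ν i)) ∧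
      condDistrib (fun ω i => Y i ω) Z μ z = Measure.pi ν) :
    ∑ i, condMutualInfo W (Y i) Z μ ≤ condMutualInfo W (fun ω i => Y i ω) Z μ := by
  refine (sum_lintegral_le_lintegral_sum _ _ _).trans (lintegral_mono_ae ?_)
  have h1 : ∀ᵐ z ∂(μ.map Z), ∀ i, condDistrib (fun ω => (W ω, Y i ω)) Z μ z
      = (condDistrib (fun ω => (W ω, fun i => Y i ω)) Z μ z).map (fun q => (q.1, q.2 i)) :=
    ae_all_iff.2 fun i => condDistrib_comp_apply Z (hW.prodMk hY)
      (g := fun q : 𝒲 × (Fin n → α) => (q.1, q.2 i)) (by fun_prop)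
  have h2 : ∀ᵐ z ∂(μ.map Z), ∀ i, condDistrib (Y i) Z μ z
      = (condDistrib (fun ω i => Y i ω) Z μ z).map (fun s => s i) :=
    ae_all_iff.2 fun i => condDistrib_comp_apply Z hY
      (g := fun s : Fin n → α => s i) (by fun_prop)
  have h3 := condDistrib_comp_apply Z (hW.prodMk hY) measurable_fst
  filter_upwards [h, h1, h2, h3] with z ⟨ν, hν, hz⟩ hz1 hz2 hz3
  have h4 (i : Fin n) : condDistrib (Y i) Z μ z = ν i := by
    rw [hz2, hz]
    exact (measurePreserving_eval ν i).map_eq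
  simp only [disintegratedMutualInfo]
  simp_rw [hz1, h4, hz]
  rw [hz3]
  exact sum_klDiv_map_le_klDiv_pi ν _

end Superadditivity

/-! ### Conditional independence of the training examples given the starting point -/

section Start

variable {Ω α 𝒵 : Type*} [MeasurableSpace Ω] [MeasurableSpace α] [MeasurableSpace 𝒵]
  {μ : Measure Ω} [IsProbabilityMeasure μ]

/-- If `Z` is drawn from `Q (s j)`, where the `s i` are i.i.d., then `(Z, s j)` is independent of
the other coordinates. -/
lemma map_pi_compProd_comap_eval {n : ℕ} (P : Measure α) [IsProbabilityMeasure P]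
    (Q : Kernel α 𝒵) [IsMarkovKernel Q] (j : Fin (n + 1)) :
    ((Measure.pi fun _ : Fin (n + 1) => P) ⊗ₘ
        Q.comap (fun s : Fin (n + 1) → α => s j) (measurable_pi_apply j)).map
        (fun q => ((q.2, q.1 j), fun i => q.1 (j.succAbove i)))
      = ((P ⊗ₘ Q).map Prod.swap).prod (Measure.pi fun _ : Fin n => P) := by
  have hg : Measurable fun q : (Fin (n + 1) → α) × 𝒵 =>
      ((q.2, q.1 j), fun i => q.1 (j.succAbove i)) := by fun_prop
  refine Measure.ext_of_lintegral _ fun f hf => ?_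
  have hfr : Measurable fun p : α × 𝒵 => ∫⁻ r, f (p.swap, r) ∂(Measure.pi fun _ : Fin n => P) :=
    hf.lintegral_prod_right'.comp measurable_swap
  rw [lintegral_map hf hg, Measure.lintegral_compProd (by fun_prop),
    lintegral_prod _ hf.aemeasurable, lintegral_map hf.lintegral_prod_right' measurable_swap,
    Measure.lintegral_compProd hfr]
  have hF : Measurable fun p : α × (Fin n → α) => ∫⁻ z, f ((z, p.1), p.2) ∂(Q p.1) := by
    have h := Measurable.lintegral_kernel_prod_right' (κ := Q.comap Prod.fst measurable_fst)
      (f := fun r : (α × (Fin n → α)) × 𝒵 => f ((r.2, r.1.1), r.1.2)) (by fun_prop)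
    simpa [Kernel.comap_apply] using h
  have hpi := (measurePreserving_piFinSuccAbove (fun _ : Fin (n + 1) => P) j).lintegral_comp hF
  rw [lintegral_prod _ hF.aemeasurable] at hpi
  refine Eq.trans hpi (lintegral_congr fun a => ?_)
  exact lintegral_lintegral_swap (μ := Measure.pi fun _ : Fin n => P) (ν := Q a)
    (f := fun (r : Fin n → α) (z : 𝒵) => f ((z, a), r)) (by fun_prop)

/-- I.i.d. examples stay independent given a variable drawn from a kernel at the `j`-th one: the
conditional law only changes the `j`-th factor. -/
lemma condDistrib_eq_pi_of_hasLaw [StandardBorelSpace α] [Nonempty α] {m : ℕ}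
    (P : Measure α) [IsProbabilityMeasure P] (Q : Kernel α 𝒵) [IsMarkovKernel Q] (j : Fin m)
    {X : Fin m → Ω → α} {Z : Ω → 𝒵}
    (h : HasLaw (fun ω => ((fun i => X i ω), Z ω))
      ((Measure.pi fun _ : Fin m => P) ⊗ₘ
        Q.comap (fun s : Fin m → α => s j) (measurable_pi_apply j)) μ) :
    ∀ᵐ z ∂(μ.map Z), ∃ ν : Fin m → Measure α, (∀ i, IsProbabilityMeasure (ν i)) ∧
      condDistrib (fun ω i => X i ω) Z μ z = Measure.pi ν := by
  obtain _ | n := m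
  · exact j.elim0
  have hX : AEMeasurable (fun ω i => X i ω) μ := h.aemeasurable.fst
  have hZ : AEMeasurable Z μ := h.aemeasurable.snd
  have hXi (i : Fin (n + 1)) : AEMeasurable (X i) μ := (aemeasurable_pi_iff.1 hX) i
  have hrest : AEMeasurable (fun ω (i : Fin n) => X (j.succAbove i) ω) μ :=
    aemeasurable_pi_iff.2 fun i => hXi _
  have hlaw : μ.map (fun ω => ((Z ω, X j ω), fun i => X (j.succAbove i) ω))
      = ((P ⊗ₘ Q).map Prod.swap).prod (Measure.pi fun _ : Fin n => P) := by
    rw [← map_pi_compProd_comap_eval P Q j, ← h.map_eq,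
      AEMeasurable.map_map_of_aemeasurable (by fun_prop) h.aemeasurable]
    rfl
  have : IsProbabilityMeasure ((P ⊗ₘ Q).map Prod.swap) :=
    Measure.isProbabilityMeasure_map (by fun_prop)
  have hfst : μ.map (fun ω => (Z ω, X j ω)) = (P ⊗ₘ Q).map Prod.swap := by
    rw [← Measure.fst_map_prodMk₀ (X := fun ω => (Z ω, X j ω)) hrest, hlaw, Measure.fst_prod]
  have hsnd : μ.map (fun ω (i : Fin n) => X (j.succAbove i) ω)
      = Measure.pi fun _ : Fin n => P := by
    rw [← Measure.snd_map_prodMk₀ (X := fun ω => (Z ω, X j ω))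
      (hZ.prodMk (hXi j)), hlaw, Measure.snd_prod]
  have hind : IndepFun (fun ω => (Z ω, X j ω)) (fun ω (i : Fin n) => X (j.succAbove i) ω) μ := by
    rw [indepFun_iff_map_prod_eq_prod_map_map (hZ.prodMk (hXi j)) hrest, hlaw, hfst, hsnd]
  have hcond := condDistrib_comp_prodMk_of_indepFun (hXi j) hrest hZ hind
    (MeasurableEquiv.piFinSuccAbove (fun _ : Fin (n + 1) => α) j).symm.measurable
  filter_upwards [hcond] with z hz
  let ν : Fin (n + 1) → Measure α := fun i => if i = j then condDistrib (X j) Z μ z else P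
  have hν (i : Fin (n + 1)) : IsProbabilityMeasure (ν i) := by
    dsimp only [ν]
    split_ifs <;> infer_instance
  refine ⟨ν, hν, ?_⟩
  have hsymm := ((measurePreserving_piFinSuccAbove ν j).symm _).map_eq
  have hνj : ν j = condDistrib (X j) Z μ z := if_pos rfl
  have hνs (i : Fin n) : ν (j.succAbove i) = P := if_neg (Fin.succAbove_ne j i)
  simp only [hνj, hνs] at hsymm
  rw [hsnd, hsymm] at hz
  have hS : (fun ω => (MeasurableEquiv.piFinSuccAbove (fun _ : Fin (n + 1) => α) j).symm
      (X j ω, fun i => X (j.succAbove i) ω)) = fun ω i => X i ω :=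
    funext fun ω => (MeasurableEquiv.piFinSuccAbove (fun _ : Fin (n + 1) => α) j).symm_apply_apply
      (fun i => X i ω)
  rwa [hS] at hz

end Start

/-! ### Relative entropy along the noisy iterates -/

section Iterates

variable {d : ℕ} {𝒴 𝒴' 𝒮 𝒳 : Type*} [MeasurableSpace 𝒴] [MeasurableSpace 𝒴'] [MeasurableSpace 𝒮]
  [MeasurableSpace 𝒳]

/-- Relative entropy increases by at most `C / 2` in a step that shifts the noise by a vector of
squared norm at most `C` under the first law only: the chain rule applies to the pair of the state
and the noise, and the data processing inequality to the update `h`. -/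
lemma klDiv_map_shifted_noise_le {u : 𝒴 → EuclideanSpace ℝ (Fin d)} (hu : Measurable u)
    (p q : Measure 𝒴) [IsProbabilityMeasure p] [IsProbabilityMeasure q] {C : ℝ}
    (hC : ∀ y, ‖u y‖ ^ 2 ≤ C) {h : 𝒴 × EuclideanSpace ℝ (Fin d) → 𝒴'} (hh : Measurable h) :
    klDiv ((p.prod (stdGaussian (EuclideanSpace ℝ (Fin d)))).map
          (fun r => h (r.1, r.2 + u r.1)))
        ((q.prod (stdGaussian (EuclideanSpace ℝ (Fin d)))).map h)
      ≤ klDiv p q + ENNReal.ofReal (C / 2) := by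
  have := isMarkovKernel_gaussianShiftKernel hu
  have hmap : (p.prod (stdGaussian (EuclideanSpace ℝ (Fin d)))).map
      (fun r => h (r.1, r.2 + u r.1)) = (p ⊗ₘ gaussianShiftKernel u).map h := by
    rw [compProd_gaussianShiftKernel hu, Measure.map_map hh (by fun_prop)]
    rfl
  rw [hmap, ← Measure.compProd_const]
  refine (klDiv_map_le _ _ hh).trans ?_
  rw [klDiv_compProd_eq_add]
  gcongr
  exact klDiv_compProd_gaussianShiftKernel_le hu p hC

/-- An update of the second coordinate by a function of itself and of independent noise keeps a
product law a product law. -/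
lemma map_prod_prod_update (σ : Measure 𝒮) [IsProbabilityMeasure σ] (η : Measure 𝒳)
    [IsProbabilityMeasure η] (γ : Measure 𝒴) [IsProbabilityMeasure γ] {g : 𝒳 × 𝒴 → 𝒳}
    (hg : Measurable g) :
    ((σ.prod η).prod γ).map (fun r => (r.1.1, g (r.1.2, r.2)))
      = σ.prod ((η.prod γ).map g) := by
  conv_rhs => rw [← Measure.map_id (μ := σ)]
  rw [Measure.map_prod_map _ _ measurable_id hg, ← Measure.prodAssoc_prod,
    Measure.map_map (by fun_prop) (by fun_prop)]
  rfl

variable {Ω 𝒵 : Type*} [MeasurableSpace Ω] [MeasurableSpace 𝒵] {μ : Measure Ω}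
  [IsProbabilityMeasure μ]

/-- The state of a recursion driven by independent noise is independent of the noise still to
come. -/
lemma indepFun_state_remaining_noise {N : ℕ} {ε : Fin N → Ω → 𝒳} (hε : ∀ k, AEMeasurable (ε k) μ)
    (hε_indep : iIndepFun ε μ) {U : Fin (N + 1) → Ω → 𝒴} (hU0 : AEMeasurable (U 0) μ)
    (h0 : IndepFun (U 0) (fun ω k => ε k ω) μ) {g : Fin N → 𝒴 × 𝒳 → 𝒴}
    (hg : ∀ k, Measurable (g k)) (hU : ∀ k ω, U k.succ ω = g k (U k.castSucc ω, ε k ω))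
    (k : Fin (N + 1)) :
    AEMeasurable (U k) μ ∧
      IndepFun (U k)
        (fun ω (i : Finset.univ.filter fun i : Fin N => k ≤ i.castSucc) => ε i ω) μ := by
  induction k using Fin.induction with
  | zero =>
    exact ⟨hU0, h0.comp (φ := id) (ψ := fun (e : Fin N → 𝒳)
      (i : Finset.univ.filter fun i : Fin N => 0 ≤ i.castSucc) => e i)
      measurable_id (by fun_prop)⟩
  | succ k ih =>
    obtain ⟨hUk, hind⟩ := ih
    have hmem (i : Finset.univ.filter fun i : Fin N => k.succ ≤ i.castSucc) :
        (i : Fin N) ∈ Finset.univ.filter fun i : Fin N => k.castSucc ≤ i.castSucc := by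
      have h := (Finset.mem_filter.1 i.2).2
      exact Finset.mem_filter.2 ⟨Finset.mem_univ _, (Fin.castSucc_lt_succ.le).trans h⟩
    have hkmem : k ∈ Finset.univ.filter fun i : Fin N => k.castSucc ≤ i.castSucc := by simp
    have hrest : AEMeasurable (fun ω (i : Finset.univ.filter fun i : Fin N =>
        k.succ ≤ i.castSucc) => ε i ω) μ := aemeasurable_pi_iff.2 fun i => hε i
    have hdisj : Disjoint {k} (Finset.univ.filter fun i : Fin N => k.succ ≤ i.castSucc) := by
      rw [Finset.disjoint_singleton_left, Finset.mem_filter]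
      exact fun h => absurd h.2 (not_le.2 Fin.castSucc_lt_succ)
    have hnoise : IndepFun (ε k) (fun ω (i : Finset.univ.filter fun i : Fin N =>
        k.succ ≤ i.castSucc) => ε i ω) μ :=
      (hε_indep.indepFun_finset₀ {k} _ hdisj hε).comp
        (φ := fun e : ({k} : Finset (Fin N)) → 𝒳 => e ⟨k, Finset.mem_singleton_self k⟩) (ψ := id)
        (by fun_prop) measurable_id
    have hsplit : IndepFun (U k.castSucc) (fun ω => (ε k ω, fun (i : Finset.univ.filter
        fun i : Fin N => k.succ ≤ i.castSucc) => ε i ω)) μ :=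
      hind.comp (φ := id) (ψ := fun e : (Finset.univ.filter
          fun i : Fin N => k.castSucc ≤ i.castSucc) → 𝒳 =>
        (e ⟨k, hkmem⟩, fun (i : Finset.univ.filter fun i : Fin N => k.succ ≤ i.castSucc) =>
          e ⟨i, hmem i⟩)) measurable_id (by fun_prop)
    have hpair := IndepFun.prodMk_left_of_prodMk_right hUk (hε k) hrest hsplit hnoise
    have hUeq : U k.succ = fun ω => g k (U k.castSucc ω, ε k ω) := funext (hU k)
    rw [hUeq]
    exact ⟨(hg k).comp_aemeasurable (hUk.prodMk (hε k)), hpair.comp (hg k) measurable_id⟩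

variable [StandardBorelSpace 𝒮] [Nonempty 𝒮]

/-- Consider iterates `x ↦ g (x, e + u (S, x))` with Gaussian noise `e`, started at a point `Z`.
Conditionally on the starting point, the joint law of `S` and of the `k`-th iterate is within
relative entropy `∑_{i < k} C i / 2` of a law under which they are independent, the one obtained
by removing the drifts `u`. -/
lemma exists_klDiv_condDistrib_iterate_le {N : ℕ} {S : Ω → 𝒮} (hS : AEMeasurable S μ)
    {x : Fin (N + 1) → Ω → EuclideanSpace ℝ (Fin d)} (hx0 : AEMeasurable (x 0) μ)
    {ε : Fin N → Ω → EuclideanSpace ℝ (Fin d)}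
    (hε : ∀ k, HasLaw (ε k) (stdGaussian (EuclideanSpace ℝ (Fin d))) μ)
    (hε_indep : iIndepFun ε μ)
    (hε_start : IndepFun (fun ω => (S ω, x 0 ω)) (fun ω k => ε k ω) μ)
    {u : Fin N → 𝒮 × EuclideanSpace ℝ (Fin d) → EuclideanSpace ℝ (Fin d)}
    (hu : ∀ k, Measurable (u k)) {C : ℕ → ℝ} (hC : ∀ k y, ‖u k y‖ ^ 2 ≤ C k)
    {g : Fin N → EuclideanSpace ℝ (Fin d) × EuclideanSpace ℝ (Fin d) → EuclideanSpace ℝ (Fin d)}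
    (hg : ∀ k, Measurable (g k))
    (hx : ∀ (k : Fin N) ω, x k.succ ω
      = g k (x k.castSucc ω, ε k ω + u k (S ω, x k.castSucc ω)))
    (k : Fin (N + 1)) :
    AEMeasurable (x k) μ ∧ ∀ᵐ z ∂(μ.map (x 0)), ∃ η : Measure (EuclideanSpace ℝ (Fin d)),
      IsProbabilityMeasure η ∧
      klDiv (condDistrib (fun ω => (S ω, x k ω)) (x 0) μ z)
          ((condDistrib S (x 0) μ z).prod η)
        ≤ ∑ i ∈ Finset.range k, ENNReal.ofReal (C i / 2) := by
  have hstate (k : Fin (N + 1)) := indepFun_state_remaining_noise (fun k => (hε k).aemeasurable)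
    hε_indep (U := fun k ω => (x 0 ω, S ω, x k ω)) (by fun_prop)
    (hε_start.comp (φ := fun q => (q.2, q.1, q.2)) (by fun_prop) measurable_id)
    (g := fun k r => (r.1.1, r.1.2.1, g k (r.1.2.2, r.2 + u k r.1.2)))
    (fun k => by have := hg k; have := hu k; fun_prop)
    (fun k ω => by simp only [hx]) k
  have hxm (k : Fin (N + 1)) : AEMeasurable (x k) μ := (hstate k).1.snd.snd
  refine ⟨hxm k, ?_⟩
  induction k using Fin.induction with
  | zero =>
    filter_upwards [condDistrib_prodMk_self hS hx0] with z hz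
    exact ⟨Measure.dirac z, inferInstance, by simp [hz]⟩
  | succ k ih =>
    have hind : IndepFun (fun ω => (x 0 ω, S ω, x k.castSucc ω)) (ε k) μ :=
      (hstate k.castSucc).2.comp (φ := id) (ψ := fun e : (Finset.univ.filter
        fun i : Fin N => k.castSucc ≤ i.castSucc) → EuclideanSpace ℝ (Fin d) =>
          e ⟨k, by simp⟩) measurable_id (by fun_prop)
    have hgk := hg k
    have huk := hu k
    have hstep := condDistrib_comp_prodMk_of_indepFun (hS.prodMk (hxm k.castSucc))
      (hε k).aemeasurable hx0 hind
      (g := fun r => (r.1.1, g k (r.1.2, r.2 + u k r.1))) (by fun_prop)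
    simp only [← hx, (hε k).map_eq] at hstep
    filter_upwards [ih, hstep] with z ⟨η, hη, hle⟩ hz
    refine ⟨(η.prod (stdGaussian (EuclideanSpace ℝ (Fin d)))).map (g k),
      Measure.isProbabilityMeasure_map (hg k).aemeasurable, ?_⟩
    rw [hz, ← map_prod_prod_update _ η _ (hg k)]
    refine (klDiv_map_shifted_noise_le (hu k) _ _ (hC k)
      (h := fun r => (r.1.1, g k (r.1.2, r.2))) (by fun_prop)).trans ?_
    rw [Fin.val_succ, Finset.sum_range_succ]
    gcongr
    exact hle

/-- The bound on the relative entropy to a decoupled law is a bound on the conditional mutual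
information between the last iterate and `S`. -/
lemma condMutualInfo_le_of_klDiv_le {𝒳 : Type*} [MeasurableSpace 𝒳] [StandardBorelSpace 𝒳]
    [Nonempty 𝒳] {S : Ω → 𝒮} {W : Ω → 𝒳} {Z : Ω → 𝒵} (hS : AEMeasurable S μ)
    (hW : AEMeasurable W μ) (hZ : AEMeasurable Z μ) {c : ℝ≥0∞}
    (h : ∀ᵐ z ∂(μ.map Z), ∃ η : Measure 𝒳, IsProbabilityMeasure η ∧
      klDiv (condDistrib (fun ω => (S ω, W ω)) Z μ z) ((condDistrib S Z μ z).prod η) ≤ c) :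
    condMutualInfo W S Z μ ≤ c := by
  have := Measure.isProbabilityMeasure_map (μ := μ) hZ
  have hWS := hW.prodMk hS
  have key : ∀ᵐ z ∂(μ.map Z), disintegratedMutualInfo W S Z μ z ≤ c := by
    filter_upwards [h, condDistrib_comp_apply Z hWS measurable_swap,
      condDistrib_comp_apply Z hWS measurable_fst, condDistrib_comp_apply Z hWS measurable_snd]
      with z ⟨η, hη, hle⟩ hswap hfst hsnd
    set ρ := condDistrib (fun ω => (W ω, S ω)) Z μ z
    simp only [Prod.swap_prod_mk] at hswap
    rw [hswap, hsnd, ← Measure.prod_swap] at hle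
    rw [disintegratedMutualInfo, hfst, hsnd]
    refine (klDiv_prod_marginals_le ρ η).trans ?_
    have hcomm := klDiv_map_measurableEquiv MeasurableEquiv.prodComm ρ (η.prod ρ.snd)
    rw [← hcomm]
    exact hle
  calc condMutualInfo W S Z μ ≤ ∫⁻ _, c ∂(μ.map Z) := lintegral_mono_ae key
    _ = c := by simp

end Iterates

/-! ### The generalization bound -/

/-- Notation: `X i` are the training examples and `S = (X i)_i` the training set, `θ = train S` the
learned parameter, `score θ` the score model, and `Xhat k` is the generated sample at the time
`t_k = T - k T / N`, so that `Xhat 0` is the starting point (at time `T`) and `Xhat (Fin.last N)` is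
the output (at time `0`). Given `S`, the starting point has law `Q (X j)`: a constant kernel `Q` is
a start from a prior independent of `S`, and the forward (encoder) kernel `Q` is a start from the
diffused example `X j`. -/
theorem mainTheorem3 {d m N : ℕ} {Ω Θ : Type*} [MeasurableSpace Ω] [MeasurableSpace Θ]
    (hN : 0 < N) (T : ℝ) (hT : 0 < T) (lam : ℝ → ℝ) (L : ℝ)
    (μ : Measure Ω) [IsProbabilityMeasure μ]
    (P : Measure (EuclideanSpace ℝ (Fin d))) [IsProbabilityMeasure P]
    (Q : Kernel (EuclideanSpace ℝ (Fin d)) (EuclideanSpace ℝ (Fin d))) [IsMarkovKernel Q]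
    (X : Fin m → Ω → EuclideanSpace ℝ (Fin d))
    (Xhat : Fin (N + 1) → Ω → EuclideanSpace ℝ (Fin d))
    (ε : Fin N → Ω → EuclideanSpace ℝ (Fin d))
    (train : (Fin m → EuclideanSpace ℝ (Fin d)) → Θ) (htrain : Measurable train)
    (score : Θ → EuclideanSpace ℝ (Fin d) → ℝ → EuclideanSpace ℝ (Fin d))
    (hscore : ∀ t ∈ Set.Icc 0 T,
      Measurable fun p : Θ × EuclideanSpace ℝ (Fin d) => score p.1 p.2 t)
    (hL : ∀ S x, ∀ t ∈ Set.Icc 0 T, ‖score (train S) x t‖ ≤ L)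
    (j : Fin m)
    (hstart : HasLaw (fun ω => ((fun i => X i ω), Xhat 0 ω))
      ((Measure.pi fun _ : Fin m => P) ⊗ₘ
        Q.comap (fun S : Fin m → EuclideanSpace ℝ (Fin d) => S j) (measurable_pi_apply j)) μ)
    (hε : ∀ k, HasLaw (ε k) (stdGaussian (EuclideanSpace ℝ (Fin d))) μ)
    (hε_indep : iIndepFun ε μ)
    (hε_start : IndepFun (fun ω => ((fun i => X i ω), Xhat 0 ω)) (fun ω k => ε k ω) μ)
    (hstep : ∀ (k : Fin N) (ω : Ω),
      Xhat k.succ ω = eulerMaruyamaStep T (T / N) lam (score (train fun i => X i ω))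
        (backwardTime T N k) (Xhat k.castSucc ω) (ε k ω)) :
    (m : ℝ≥0∞)⁻¹ * ∑ i, condMutualInfo (Xhat (Fin.last N)) (X i) (Xhat 0) μ
        ≤ (m : ℝ≥0∞)⁻¹ *
          condMutualInfo (Xhat (Fin.last N)) (fun ω i => X i ω) (Xhat 0) μ ∧
      (m : ℝ≥0∞)⁻¹ * condMutualInfo (Xhat (Fin.last N)) (fun ω i => X i ω) (Xhat 0) μ
        ≤ ENNReal.ofReal
          (T * L ^ 2 * (∑ k ∈ Finset.Icc 1 N, lam (((k : ℝ) - 1) * T / N) ^ 2) / (2 * m * N)) := by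
  have hS : AEMeasurable (fun ω i => X i ω) μ := hstart.aemeasurable.fst
  have hx0 : AEMeasurable (Xhat 0) μ := hstart.aemeasurable.snd
  have hN' : (0 : ℝ) < N := by exact_mod_cast hN
  have hτ : 0 ≤ T / N := by positivity
  have htime (k : ℕ) : T - backwardTime T N k = T / N * k := by
    unfold backwardTime
    ring
  have htime_mem (k : Fin N) : T / N * (k : ℕ) ∈ Set.Icc 0 T := by
    refine ⟨by positivity, ?_⟩
    have hk : ((k : ℕ) : ℝ) ≤ N := by exact_mod_cast k.2.le
    calc T / N * (k : ℕ) ≤ T / N * N := by gcongr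
      _ = T := by field_simp
  -- since the drift is `τ λ² s = (√τ λ) (√τ λ s)`, a step adds to the noise the drift
  -- `u = √τ λ s`; this form needs no division and so covers `λ = 0`
  let u : Fin N → (Fin m → EuclideanSpace ℝ (Fin d)) × EuclideanSpace ℝ (Fin d) →
      EuclideanSpace ℝ (Fin d) := fun k y =>
    (Real.sqrt (T / N) * lam (T / N * (k : ℕ))) • score (train y.1) y.2 (T / N * (k : ℕ))
  let g : Fin N → EuclideanSpace ℝ (Fin d) × EuclideanSpace ℝ (Fin d) →
      EuclideanSpace ℝ (Fin d) := fun k r =>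
    (1 - T / N / 2 * lam (T / N * (k : ℕ)) ^ 2) • r.1
      + (Real.sqrt (T / N) * lam (T / N * (k : ℕ))) • r.2
  have hu (k : Fin N) : Measurable (u k) := by
    have hpair : Measurable fun y : (Fin m → EuclideanSpace ℝ (Fin d)) ×
        EuclideanSpace ℝ (Fin d) => (train y.1, y.2) := by fun_prop
    have h := (hscore _ (htime_mem k)).comp hpair
    exact h.const_smul (Real.sqrt (T / N) * lam (T / N * (k : ℕ)))
  have hg (k : Fin N) : Measurable (g k) := by fun_prop
  have hC (k : Fin N) (y) :
      ‖u k y‖ ^ 2 ≤ (fun i : ℕ => T / N * lam (T / N * i) ^ 2 * L ^ 2) k := by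
    have hs := hL y.1 y.2 _ (htime_mem k)
    simp only [u]
    rw [norm_smul, mul_pow, Real.norm_eq_abs, sq_abs, mul_pow, Real.sq_sqrt hτ]
    gcongr
  have hx (k : Fin N) (ω : Ω) : Xhat k.succ ω = g k (Xhat k.castSucc ω,
      ε k ω + u k ((fun i => X i ω), Xhat k.castSucc ω)) := by
    rw [hstep k ω, eulerMaruyamaStep, htime]
    simp only [g, u]
    rw [smul_add, smul_smul, mul_mul_mul_comm, Real.mul_self_sqrt hτ, ← sq]
    abel
  have hiter (k : Fin (N + 1)) := exists_klDiv_condDistrib_iterate_le hS hx0 hε hε_indep hε_start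
    hu (C := fun i => T / N * lam (T / N * i) ^ 2 * L ^ 2) hC hg hx k
  have hsub := sum_condMutualInfo_le_of_condDistrib_eq_pi (hiter (Fin.last N)).1 hS
    (condDistrib_eq_pi_of_hasLaw P Q j hstart)
  have hinfo := condMutualInfo_le_of_klDiv_le hS (hiter (Fin.last N)).1 hx0 (hiter (Fin.last N)).2
  refine ⟨by gcongr, ?_⟩
  have hm : (0 : ℝ) < m := by exact_mod_cast j.pos
  calc (m : ℝ≥0∞)⁻¹ * condMutualInfo (Xhat (Fin.last N)) (fun ω i => X i ω) (Xhat 0) μ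
      ≤ (m : ℝ≥0∞)⁻¹ * ∑ i ∈ Finset.range N,
          ENNReal.ofReal (T / N * lam (T / N * i) ^ 2 * L ^ 2 / 2) := by
        gcongr
        exact hinfo
    _ = ENNReal.ofReal ((m : ℝ)⁻¹ * ∑ i ∈ Finset.range N,
          T / N * lam (T / N * i) ^ 2 * L ^ 2 / 2) := by
        rw [ENNReal.ofReal_mul (by positivity), ENNReal.ofReal_inv_of_pos hm,
          ENNReal.ofReal_natCast, ENNReal.ofReal_sum_of_nonneg fun i _ => by positivity]
    _ = _ := by
        have hsum : ∑ k ∈ Finset.Icc 1 N, lam (((k : ℝ) - 1) * T / N) ^ 2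
            = ∑ i ∈ Finset.range N, lam (T / N * i) ^ 2 := by
          rw [Finset.range_eq_Ico, ← Finset.Ico_add_one_right_eq_Icc,
            ← Finset.sum_Ico_add' (fun k : ℕ => lam (((k : ℝ) - 1) * T / N) ^ 2) 0 N 1]
          refine Finset.sum_congr rfl fun i _ => ?_
          push_cast
          congr 2
          ring
        rw [hsum, ← Finset.sum_div, ← Finset.sum_mul, ← Finset.mul_sum]
        congr 1
        field_simp
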